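/- There is an absolute constant $C>0$ such that the following holds. Let $G=(V,F,w)$ be a finite weighted graph with $n=|V|$ vertices (no loops, parallel edges allowed) and edge weights $w(f)\ge 0$, which is connected through its edges of positive weight. Let $L_G$ be its Laplacian, i.e. $(L_G)_{uu}$ is the total weight of the edges incident to $u$ and, for $u\ne v$, $-(L_G)_{uv}$ is the total weight of the edges between $u$ and $v$. Let $L_G^+$ be the Moore–Penrose pseudo-inverse of $L_G$, let $R_G(u,v)=(\chi_u-\chi_v)^\top L_G^+(\chi_u-\chi_v)$ be the effective resistance, where $\chi_u\in\mathbb R^V$ is the indicator vector of $u$, and let $S^G=\{x\in\mathbb R^V : x^\top L_G x=1\}$. Then for every $\epsilon>0$ and every $i\in\mathbb N=\{0,1,2,\dots\}$ there is a function $\varphi_i:S^G\to\mathbb R^V$ such that, writing $x^{(i)}:=\varphi_i(x)$: 1. the image of $\varphi_i$ is finite, and $|\varphi_i(S^G)|\le\exp\left(800\,C\log n\cdot 2^i/\epsilon^2\right)$; 2. for every $x\in S^G$ and every edge $f\in F$ with end points $u,v$ such that $\max\left((x_u-x_v)^2,(x^{(i)}_u-x^{(i)}_v)^2\right)\ge 2^{-i}\cdot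 R_G(u,v)$, $$\left(1-\frac{\epsilon}{7}\right)(x^{(i)}_u-x^{(i)}_v)^2\le(x_u-x_v)^2\le\left(1+\frac{\epsilon}{7}\right)(x^{(i)}_u-x^{(i)}_v)^2 .$$ -/

import Mathlib

/-- A weighted graph with vertex set `V` and edge set `F`: every edge has two distinct, unordered
end points and a nonnegative weight. Parallel edges are allowed. -/
structure WeightedGraph (V F : Type*) where
  ends : F → Sym2 V
  not_loop : ∀ f, ¬ (ends f).IsDiag
  weight : F → ℝ
  weight_nonneg : ∀ f, 0 ≤ weight f

/-- `B` is the Moore-Penrose pseudo-inverse of the real matrix `A` (the four Penrose equations). -/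
structure IsMoorePenroseInverse {V : Type*} [Fintype V] (A B : Matrix V V ℝ) : Prop where
  mul_mul_left : A * B * A = A
  mul_mul_right : B * A * B = B
  isSymm_left : (A * B).transpose = A * B
  isSymm_right : (B * A).transpose = B * A

theorem IsMoorePenroseInverse.unique {V : Type*} [Fintype V] {A B C : Matrix V V ℝ}
    (hB : IsMoorePenroseInverse A B) (hC : IsMoorePenroseInverse A C) : B = C := by
  have h1 : A * B = A * C := by
    calc A * B = (A * B).transpose := hB.isSymm_left.symm
      _ = ((A * C) * (A * B)).transpose := by
          rw [← Matrix.mul_assoc, hC.mul_mul_left]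
      _ = (A * B) * (A * C) := by
          rw [Matrix.transpose_mul, hB.isSymm_left, hC.isSymm_left]
      _ = A * C := by rw [← Matrix.mul_assoc, hB.mul_mul_left]
  have h2 : B * A = C * A := by
    calc B * A = (B * A).transpose := hB.isSymm_right.symm
      _ = ((B * A) * (C * A)).transpose := by
          rw [Matrix.mul_assoc B A, ← Matrix.mul_assoc A C A, hC.mul_mul_left]
      _ = (C * A) * (B * A) := by
          rw [Matrix.transpose_mul, hB.isSymm_right, hC.isSymm_right]
      _ = C * A := by rw [Matrix.mul_assoc C A, ← Matrix.mul_assoc A B A, hB.mul_mul_left]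
  calc B = B * A * B := hB.mul_mul_right.symm
    _ = C * A * C := by rw [h2, Matrix.mul_assoc, h1, Matrix.mul_assoc]
    _ = C := hC.mul_mul_right

theorem exists_isMoorePenroseInverse {V : Type*} [Fintype V] [DecidableEq V]
    {A : Matrix V V ℝ} (hA : A.transpose = A) : ∃ B, IsMoorePenroseInverse A B := by
  have hH : A.IsHermitian := by
    rw [Matrix.IsHermitian, Matrix.conjTranspose_eq_transpose_of_trivial, hA]
  obtain ⟨U, d, hU, hAd⟩ : ∃ (U : Matrix V V ℝ) (d : V → ℝ), U.transpose * U = 1 ∧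
      A = U * Matrix.diagonal d * U.transpose := by
    refine ⟨(hH.eigenvectorUnitary : Matrix V V ℝ), hH.eigenvalues, ?_, ?_⟩
    · have := Unitary.coe_star_mul_self hH.eigenvectorUnitary
      rwa [Matrix.star_eq_conjTranspose,
        Matrix.conjTranspose_eq_transpose_of_trivial] at this
    · have := hH.spectral_theorem
      rw [Unitary.conjStarAlgAut_apply] at this
      simpa [Matrix.star_eq_conjTranspose,
        Matrix.conjTranspose_eq_transpose_of_trivial, Function.comp_def] using this
  have key : ∀ a b : V → ℝ, U * Matrix.diagonal a * U.transpose *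
      (U * Matrix.diagonal b * U.transpose) =
      U * Matrix.diagonal (fun v => a v * b v) * U.transpose := by
    intro a b
    rw [← Matrix.diagonal_mul_diagonal]
    calc _ = U * Matrix.diagonal a * (U.transpose * U) * Matrix.diagonal b * U.transpose := by
          simp only [Matrix.mul_assoc]
      _ = _ := by rw [hU, Matrix.mul_one]; simp only [Matrix.mul_assoc]
  refine ⟨U * Matrix.diagonal (fun v => (d v)⁻¹) * U.transpose, ?_, ?_, ?_, ?_⟩
  · rw [hAd, key, key]
    congr; funext v; exact mul_inv_mul_cancel (d v)
  · rw [hAd, key, key]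
    congr; funext v; simpa using mul_inv_mul_cancel (d v)⁻¹
  · rw [hAd, key]
    simp [Matrix.transpose_mul, Matrix.mul_assoc]
  · rw [hAd, key]
    simp [Matrix.transpose_mul, Matrix.mul_assoc]

open Classical in
/-- The Moore-Penrose pseudo-inverse of a square real matrix. -/
noncomputable def pseudoInverse {V : Type*} [Fintype V] (A : Matrix V V ℝ) : Matrix V V ℝ :=
  if h : ∃ B, IsMoorePenroseInverse A B then h.choose else 0

theorem pseudoInverse_spec {V : Type*} [Fintype V] [DecidableEq V]
    {A : Matrix V V ℝ} (hA : A.transpose = A) :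
    IsMoorePenroseInverse A (pseudoInverse A) := by
  have h := exists_isMoorePenroseInverse hA
  rw [pseudoInverse, dif_pos h]
  exact h.choose_spec

namespace WeightedGraph

/-- The graph is connected; edges of weight zero do not count. -/
def Connected {V F : Type*} (G : WeightedGraph V F) : Prop :=
  (SimpleGraph.fromEdgeSet {e : Sym2 V | ∃ f, G.ends f = e ∧ 0 < G.weight f}).Connected

/-- The Laplacian `L_G`: weighted degrees on the diagonal, and minus the (total) weight of the
edges between `u` and `v` at an off-diagonal position `(u, v)`. -/
def laplacian {V F : Type*} [DecidableEq V] [Fintype F] (G : WeightedGraph V F) :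
    Matrix V V ℝ :=
  Matrix.of fun u v =>
    if u = v then ∑ f with u ∈ G.ends f, G.weight f
    else - ∑ f with G.ends f = s(u, v), G.weight f

theorem laplacian_transpose {V F : Type*} [DecidableEq V] [Fintype F]
    (G : WeightedGraph V F) : G.laplacian.transpose = G.laplacian := by
  ext u v
  by_cases h : u = v
  · subst h; rfl
  · simp [laplacian, h, Ne.symm h, Sym2.eq_swap (a := u) (b := v)]

/-- The effective resistance `R_G(u,v) = (χ_u - χ_v)ᵀ L_G⁺ (χ_u - χ_v)`. -/
noncomputable def effectiveResistance {V F : Type*} [Fintype V] [DecidableEq V] [Fintype F]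
    (G : WeightedGraph V F) (u v : V) : ℝ :=
  let b : V → ℝ := Pi.single u 1 - Pi.single v 1
  b ⬝ᵥ (pseudoInverse G.laplacian).mulVec b

/-- The set `S^G` of all `x ∈ ℝ^V` with `xᵀ L_G x = 1`. -/
def unitEnergySet {V F : Type*} [Fintype V] [DecidableEq V] [Fintype F]
    (G : WeightedGraph V F) : Set (V → ℝ) :=
  {x | x ⬝ᵥ G.laplacian.mulVec x = 1}

end WeightedGraph

/-! On a connected graph `L_G⁺ (χ_u - χ_v)` represents `x ↦ x u - x v` in the energy form and has
energy `R_G(u,v)`. Dividing by `√R` gives vectors of energy at most 1, one per pair, so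
approximating an edge difference up to `δ √R` means having a residual with small pairing against
them. A residual whose pairing exceeds `δ` loses energy more than `δ²` when `δ` times that vector is
subtracted. From energy 1 this happens at most `m = ⌊1/δ²⌋` times, so the approximants are indexed
by words of length `m` over `n²` pairs, independently of `x`. With `δ` of order `ε 2^(-i/2)`, the
error is small against the larger difference on the edges in question, hence multiplicative after
squaring. For `ε ≥ 7` the lower bound is vacuous and one constant image suffices. -/

/-- Greedy approximation with respect to a positive semidefinite form: a vector of energy less than
`(m + 1) δ²` agrees, up to `δ` in every direction `a j`, with a sum of `m` vectors `δ • a j`. -/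
theorem exists_greedy_approximation {M J : Type*} [AddCommGroup M] [Module ℝ M]
    (B : M →ₗ[ℝ] M →ₗ[ℝ] ℝ) (hsymm : ∀ x y, B x y = B y x) (hnonneg : ∀ x, 0 ≤ B x x)
    (a : J → M) (ha : ∀ j, B (a j) (a j) ≤ 1) (hzero : ∃ j, a j = 0)
    {δ : ℝ} (hδ : 0 < δ) (m : ℕ) :
    ∀ r : M, B r r < (m + 1) * δ ^ 2 →
      ∃ w : Fin m → J, ∀ j, B (r - ∑ k, δ • a (w k)) (a j) ≤ δ := by
  have step : ∀ (r : M) (j : J), δ < B r (a j) →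
      B (r - δ • a j) (r - δ • a j) < B r r - δ ^ 2 := by
    intro r j hj
    have h : B (r - δ • a j) (r - δ • a j) =
        B r r - 2 * δ * B r (a j) + δ ^ 2 * B (a j) (a j) := by
      simp only [map_sub, map_smul, LinearMap.sub_apply, LinearMap.smul_apply, smul_eq_mul,
        hsymm (a j) r]
      ring
    rw [h]
    nlinarith [mul_le_mul_of_nonneg_left (ha j) (sq_nonneg δ), mul_lt_mul_of_pos_left hj hδ]
  obtain ⟨j₀, hj₀⟩ := hzero
  induction m with
  | zero =>
    intro r hr
    refine ⟨Fin.elim0, fun j => ?_⟩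
    -- One more subtraction would make the energy negative.
    by_contra! hj
    simp only [Finset.univ_eq_empty, Finset.sum_empty, sub_zero] at hj
    have := step r j hj
    have := hnonneg (r - δ • a j)
    norm_num at hr
    linarith
  | succ m ih =>
    intro r hr
    by_cases hgood : ∀ j, B r (a j) ≤ δ
    -- The zero direction pads the word to length exactly `m + 1`.
    · exact ⟨fun _ => j₀, by simpa [hj₀] using hgood⟩
    · push Not at hgood
      obtain ⟨j, hj⟩ := hgood
      obtain ⟨w, hw⟩ := ih (r - δ • a j) (by
        have := step r j hj
        push_cast at hr
        linarith)
      refine ⟨Fin.cons j w, fun j' => ?_⟩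
      rw [Fin.sum_univ_succ]
      simpa only [Fin.cons_zero, Fin.cons_succ, sub_sub] using hw j'

/-- Two reals that differ by at most `e / 8` times the larger one have squares within a factor
`1 ± e` of each other. -/
theorem sq_le_and_le_sq_of_sub_le {a b c e : ℝ} (he : 0 < e) (he' : e < 1) (hc : 0 ≤ c)
    (hab : |a - b| ≤ e / 8 * c) (hmax : c ^ 2 ≤ max (a ^ 2) (b ^ 2)) :
    (1 - e) * b ^ 2 ≤ a ^ 2 ∧ a ^ 2 ≤ (1 + e) * b ^ 2 := by
  have hc' : c ≤ max |a| |b| := by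
    rcases le_max_iff.1 hmax with h | h
    · exact le_max_of_le_left (by simpa [abs_of_nonneg hc] using sq_le_sq.1 h)
    · exact le_max_of_le_right (by simpa [abs_of_nonneg hc] using sq_le_sq.1 h)
  have h1 : |a| - |b| ≤ e / 8 * c := (abs_sub_abs_le_abs_sub a b).trans hab
  have h2 : |b| - |a| ≤ e / 8 * c := by
    rw [abs_sub_comm] at hab
    exact (abs_sub_abs_le_abs_sub b a).trans hab
  have hec : e / 8 * c ≤ c / 8 := by nlinarith
  -- If `|a|` is the larger one, `|b|` still loses at most `c / 8`; so the error is at most `e / 7 *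
  -- |b|`, and squaring `1 ± e / 7` stays within `1 ± e`.
  have hcb : 7 / 8 * c ≤ |b| := by
    rcases le_max_iff.1 hc' with h | h <;> linarith
  have h3 : |a| - |b| ≤ e / 7 * |b| := by nlinarith
  have h4 : |b| - |a| ≤ e / 7 * |b| := by nlinarith
  rw [← sq_abs a, ← sq_abs b]
  have hb := abs_nonneg b
  have ha := abs_nonneg a
  constructor
  · have : (1 - e / 7) * |b| ≤ |a| := by linarith
    have := pow_le_pow_left₀ (by nlinarith) this 2
    nlinarith [sq_nonneg |b|, mul_nonneg he.le (sq_nonneg |b|)]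
  · have : |a| ≤ (1 + e / 7) * |b| := by linarith
    have := pow_le_pow_left₀ ha this 2
    nlinarith [sq_nonneg |b|, mul_nonneg he.le (sq_nonneg |b|),
      mul_nonneg (mul_nonneg he.le (sub_nonneg.2 he'.le)) (sq_nonneg |b|)]

/-! ### The Laplacian as an energy form -/

namespace WeightedGraph

open Matrix

variable {V F : Type*} [Fintype V] [DecidableEq V] [Fintype F] (G : WeightedGraph V F)

omit [Fintype V] [DecidableEq V] [Fintype F] in
theorem exists_ends (f : F) : ∃ u v, u ≠ v ∧ G.ends f = s(u, v) := by
  induction h : G.ends f using Sym2.ind with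
  | _ u v => exact ⟨u, v, fun huv => G.not_loop f (by simp [h, huv]), rfl⟩

omit [Fintype V] in
/-- The Laplacian is the sum of the rank-one Laplacians of the edges, for any orientation. -/
theorem laplacian_eq_sum {p q : F → V} (hpq : ∀ f, p f ≠ q f)
    (hends : ∀ f, G.ends f = s(p f, q f)) :
    G.laplacian = ∑ f, G.weight f •
      vecMulVec (Pi.single (p f) 1 - Pi.single (q f) 1 : V → ℝ)
        (Pi.single (p f) 1 - Pi.single (q f) 1) := by
  ext u v
  simp only [laplacian, of_apply, Matrix.sum_apply, Matrix.smul_apply, vecMulVec_apply,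
    smul_eq_mul, Pi.sub_apply, Pi.single_apply]
  split_ifs with huv
  · subst huv
    rw [Finset.sum_filter]
    refine Finset.sum_congr rfl fun f _ => ?_
    simp only [hends f, Sym2.mem_iff]
    by_cases h1 : u = p f
    · simp [h1, hpq f]
    · by_cases h2 : u = q f <;> simp [h1, h2, (hpq f).symm]
  · rw [Finset.sum_filter, ← Finset.sum_neg_distrib]
    refine Finset.sum_congr rfl fun f _ => ?_
    have hf := hpq f
    simp only [hends f, Sym2.eq_iff, eq_comm (a := p f), eq_comm (a := q f)]
    generalize p f = a at hf ⊢
    generalize q f = b at hf ⊢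
    by_cases h1 : u = a
    · subst h1
      by_cases h4 : v = b
      · subst h4
        simp [hf, hf.symm]
      · simp [hf, h4, Ne.symm huv]
    · by_cases h2 : u = b
      · subst h2
        by_cases h3 : v = a
        · subst h3
          simp [hf, hf.symm]
        · simp [h1, h3, Ne.symm huv]
      · simp [h1, h2]

/-- The bilinear form `(x, y) ↦ xᵀ L_G y`. -/
noncomputable def energyForm : (V → ℝ) →ₗ[ℝ] (V → ℝ) →ₗ[ℝ] ℝ :=
  Matrix.toLinearMap₂' ℝ G.laplacian

theorem energyForm_apply (x y : V → ℝ) : G.energyForm x y = x ⬝ᵥ G.laplacian *ᵥ y := by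
  simp [energyForm, Matrix.toLinearMap₂'_apply']

theorem energyForm_comm (x y : V → ℝ) : G.energyForm x y = G.energyForm y x := by
  rw [energyForm_apply, energyForm_apply, dotProduct_mulVec, ← mulVec_transpose,
    G.laplacian_transpose, dotProduct_comm]

theorem energyForm_self {p q : F → V} (hpq : ∀ f, p f ≠ q f)
    (hends : ∀ f, G.ends f = s(p f, q f)) (x : V → ℝ) :
    G.energyForm x x = ∑ f, G.weight f * (x (p f) - x (q f)) ^ 2 := by
  rw [energyForm_apply, G.laplacian_eq_sum hpq hends, Matrix.sum_mulVec, dotProduct_sum]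
  refine Finset.sum_congr rfl fun f _ => ?_
  simp only [smul_mulVec, vecMulVec_mulVec, dotProduct_smul, sub_dotProduct, dotProduct_sub,
    single_dotProduct, dotProduct_single, smul_eq_mul, MulOpposite.smul_eq_mul_unop,
    MulOpposite.unop_op]
  ring

theorem energyForm_self_nonneg (x : V → ℝ) : 0 ≤ G.energyForm x x := by
  choose p q hpq hends using G.exists_ends
  rw [G.energyForm_self hpq hends]
  exact Finset.sum_nonneg fun f _ => mul_nonneg (G.weight_nonneg f) (sq_nonneg _)

variable {G}

/-- On a connected graph only the constant vectors have energy zero. -/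
theorem Connected.eq_of_energyForm_self_eq_zero (hG : G.Connected) {x : V → ℝ}
    (hx : G.energyForm x x = 0) (u v : V) : x u = x v := by
  choose p q hpq hends using G.exists_ends
  rw [G.energyForm_self hpq hends, Finset.sum_eq_zero_iff_of_nonneg
    fun f _ => mul_nonneg (G.weight_nonneg f) (sq_nonneg _)] at hx
  obtain ⟨walk⟩ := hG.preconnected u v
  induction walk with
  | nil => rfl
  | cons hadj _ ih =>
    refine Eq.trans ?_ ih
    rw [SimpleGraph.fromEdgeSet_adj] at hadj
    obtain ⟨⟨f, hf, hw⟩, -⟩ := hadj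
    have hpq' : x (p f) = x (q f) := by
      have := (mul_eq_zero.1 (hx f (Finset.mem_univ f))).resolve_left hw.ne'
      exact sub_eq_zero.1 (pow_eq_zero_iff two_ne_zero |>.1 this)
    rw [hends f, Sym2.eq_iff] at hf
    rcases hf with ⟨h1, h2⟩ | ⟨h1, h2⟩
    all_goals rw [← h1, ← h2, hpq']

/-! ### Potentials and effective resistance -/

variable (G) in
/-- The potential `L_G⁺ (χ_u - χ_v)` of a unit current from `u` to `v`. -/
noncomputable def potential (u v : V) : V → ℝ :=
  pseudoInverse G.laplacian *ᵥ (Pi.single u 1 - Pi.single v 1)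

/-- The residual `c` lies in the kernel of the Laplacian, so it is constant by connectedness. It is
then orthogonal to `χ_u - χ_v` and to the range of the Laplacian, hence to itself. -/
theorem Connected.laplacian_mulVec_potential (hG : G.Connected) (u v : V) :
    G.laplacian *ᵥ G.potential u v = Pi.single u 1 - Pi.single v 1 := by
  have hspec := pseudoInverse_spec G.laplacian_transpose
  set b : V → ℝ := Pi.single u 1 - Pi.single v 1 with hb
  set c : V → ℝ := b - G.laplacian *ᵥ G.potential u v with hc
  have hLP : G.laplacian * (G.laplacian * pseudoInverse G.laplacian) = G.laplacian := by
    have := congrArg transpose hspec.mul_mul_left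
    rwa [transpose_mul, hspec.isSymm_left, G.laplacian_transpose] at this
  have hLc : G.laplacian *ᵥ c = 0 := by
    rw [hc, potential, mulVec_sub, mulVec_mulVec, mulVec_mulVec, Matrix.mul_assoc, hLP, sub_self]
  have hconst : c u = c v :=
    hG.eq_of_energyForm_self_eq_zero (by rw [energyForm_apply, hLc, dotProduct_zero]) u v
  have hcc : c ⬝ᵥ c = 0 := by
    have h1 : c ⬝ᵥ b = 0 := by simp [hb, dotProduct_sub, hconst]
    have h2 : c ⬝ᵥ G.laplacian *ᵥ G.potential u v = 0 := by
      rw [← energyForm_apply, energyForm_comm, energyForm_apply, hLc, dotProduct_zero]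
    calc c ⬝ᵥ c = c ⬝ᵥ b - c ⬝ᵥ G.laplacian *ᵥ G.potential u v := by
          rw [← dotProduct_sub]
      _ = 0 := by rw [h1, h2, sub_zero]
  exact (sub_eq_zero.1 (dotProduct_self_eq_zero.1 hcc)).symm

theorem Connected.energyForm_potential (hG : G.Connected) (x : V → ℝ) (u v : V) :
    G.energyForm x (G.potential u v) = x u - x v := by
  rw [energyForm_apply, hG.laplacian_mulVec_potential]
  simp [dotProduct_sub]

theorem Connected.effectiveResistance_eq (hG : G.Connected) (u v : V) :
    G.effectiveResistance u v = G.energyForm (G.potential u v) (G.potential u v) := by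
  rw [hG.energyForm_potential]
  simp [effectiveResistance, potential, sub_dotProduct]

theorem Connected.effectiveResistance_nonneg (hG : G.Connected) (u v : V) :
    0 ≤ G.effectiveResistance u v := by
  rw [hG.effectiveResistance_eq]
  exact G.energyForm_self_nonneg _

theorem Connected.effectiveResistance_pos (hG : G.Connected) {u v : V} (huv : u ≠ v) :
    0 < G.effectiveResistance u v := by
  refine (hG.effectiveResistance_nonneg u v).lt_of_ne fun h => ?_
  rw [hG.effectiveResistance_eq] at h
  set t : ℝ := G.energyForm (Pi.single u 1) (Pi.single u 1)
  have h1 : G.energyForm (Pi.single u 1) (G.potential u v) = 1 := by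
    simp [hG.energyForm_potential, huv]
  -- If the resistance vanished, this vector would have energy `t - (t + 1) = -1`.
  have h2 := G.energyForm_self_nonneg (Pi.single u 1 - ((t + 1) / 2) • G.potential u v)
  simp only [map_sub, map_smul, LinearMap.sub_apply, LinearMap.smul_apply, smul_eq_mul,
    G.energyForm_comm (G.potential u v) (Pi.single u 1), h1, ← h] at h2
  linarith

/-- The effective resistance bounds the squared potential differences of a unit energy vector. -/
theorem Connected.sq_sub_le_effectiveResistance (hG : G.Connected) {x : V → ℝ}
    (hx : x ∈ G.unitEnergySet) {u v : V} (huv : u ≠ v) :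
    (x u - x v) ^ 2 ≤ G.effectiveResistance u v := by
  have hR := hG.effectiveResistance_pos huv
  have hx' : G.energyForm x x = 1 := (G.energyForm_apply x x).trans hx
  -- Cauchy–Schwarz, through the multiple of the potential that minimizes the energy.
  have h := G.energyForm_self_nonneg
    (x - ((x u - x v) / G.effectiveResistance u v) • G.potential u v)
  simp only [map_sub, map_smul, LinearMap.sub_apply, LinearMap.smul_apply, smul_eq_mul,
    G.energyForm_comm (G.potential u v) x, hx', hG.energyForm_potential x,
    ← hG.effectiveResistance_eq] at h
  rw [div_mul_cancel₀ _ hR.ne', sub_self, mul_zero, sub_zero, div_mul_eq_mul_div, sub_nonneg,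
    div_le_one hR] at h
  rwa [sq]

/-- Every vector of energy one can be approximated, up to `δ √R` on every pair of vertices, by one
of at most `(n ^ 2) ^ m` vectors, provided that `(m + 1) δ ^ 2 > 1`. -/
theorem Connected.exists_approximation (hG : G.Connected) {δ : ℝ} (hδ : 0 < δ) {m : ℕ}
    (hm : 1 < (m + 1) * δ ^ 2) :
    ∃ y : (Fin m → V × V) → (V → ℝ), ∀ x ∈ G.unitEnergySet, ∃ w, ∀ u v, u ≠ v →
      |(x u - x v) - (y w u - y w v)| ≤ δ * √(G.effectiveResistance u v) := by
  obtain ⟨v₀⟩ := hG.nonempty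
  let a : V × V → (V → ℝ) := fun e =>
    (√(G.effectiveResistance e.1 e.2))⁻¹ • G.potential e.1 e.2
  refine ⟨fun w => ∑ k, δ • a (w k), fun x hx => ?_⟩
  have hbound : ∀ e, G.energyForm (a e) (a e) ≤ 1 := by
    intro e
    have h0 := hG.effectiveResistance_nonneg e.1 e.2
    simp only [a, map_smul, LinearMap.smul_apply, smul_eq_mul, ← hG.effectiveResistance_eq]
    rw [← mul_assoc, ← mul_inv, Real.mul_self_sqrt h0]
    exact inv_mul_le_one
  obtain ⟨w, hw⟩ := exists_greedy_approximation G.energyForm G.energyForm_comm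
    G.energyForm_self_nonneg a hbound ⟨(v₀, v₀), by simp [a, potential]⟩ hδ m x (by
      rw [energyForm_apply, show x ⬝ᵥ G.laplacian *ᵥ x = 1 from hx]
      exact hm)
  have key : ∀ u v, u ≠ v → (x u - x v) - ((∑ k, δ • a (w k)) u - (∑ k, δ • a (w k)) v) ≤
      δ * √(G.effectiveResistance u v) := by
    intro u v huv
    have h := hw (u, v)
    simp only [a, map_smul, smul_eq_mul] at h
    rw [hG.energyForm_potential, inv_mul_le_iff₀
      (Real.sqrt_pos.2 (hG.effectiveResistance_pos huv)), mul_comm] at h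
    simp only [Pi.sub_apply] at h
    linarith
  have hsymm : ∀ u v, G.effectiveResistance u v = G.effectiveResistance v u := by
    intro u v
    have h : G.potential u v = - G.potential v u := by
      rw [potential, potential, ← mulVec_neg, neg_sub]
    rw [hG.effectiveResistance_eq, hG.effectiveResistance_eq, h]
    simp
  -- The greedy bound is one-sided; swapping `u` and `v` negates the potential and gives the other
  -- side.
  refine ⟨w, fun u v huv => abs_le.2 ⟨?_, key u v huv⟩⟩
  have := key v u huv.symm
  rw [hsymm v u] at this
  linarith

end WeightedGraph

/-! ### Choice of constants and the two ranges of `ε` -/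

theorem mainTheorem4 :
    ∃ C : ℝ, 0 < C ∧
      ∀ (V : Type*) (F : Type*) [Fintype V] [DecidableEq V] [Fintype F]
        (G : WeightedGraph V F), G.Connected →
      ∀ (ε : ℝ), 0 < ε → ∀ i : ℕ,
        ∃ φ : G.unitEnergySet → (V → ℝ),
          (Set.range φ).Finite ∧
          ((Set.range φ).ncard : ℝ) ≤
            Real.exp (800 * C * Real.log (Fintype.card V) * 2 ^ i / ε ^ 2) ∧
          ∀ (x : G.unitEnergySet) (f : F) (u v : V), G.ends f = s(u, v) →
            (2 : ℝ)⁻¹ ^ i * G.effectiveResistance u v ≤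
              max ((x.1 u - x.1 v) ^ 2) ((φ x u - φ x v) ^ 2) →
            (1 - ε / 7) * (φ x u - φ x v) ^ 2 ≤ (x.1 u - x.1 v) ^ 2 ∧
              (x.1 u - x.1 v) ^ 2 ≤ (1 + ε / 7) * (φ x u - φ x v) ^ 2 := by
  -- The exponent has constant `2 * 56² = 6272`, below `800 * 8`.
  refine ⟨8, by norm_num, ?_⟩
  intro V F _ _ _ G hG ε hε i
  have hne : ∀ f u v, G.ends f = s(u, v) → u ≠ v := fun f u v h huv =>
    G.not_loop f (by simp [h, huv])
  have hn : 1 ≤ (Fintype.card V : ℝ) := by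
    have := hG.nonempty
    exact_mod_cast Fintype.card_pos
  have hlog : 0 ≤ Real.log (Fintype.card V) := Real.log_nonneg hn
  rcases lt_or_ge ε 7 with hε7 | hε7
  -- The factor `e / 8` with `e = ε / 7`, and the square root of the threshold `2^(-i)`.
  · set δ : ℝ := ε / 7 / 8 * √((2 : ℝ)⁻¹ ^ i) with hδdef
    have hδ : 0 < δ := by positivity
    have hδsq : δ ^ 2 = ε ^ 2 / (3136 * 2 ^ i) := by
      rw [hδdef, mul_pow, Real.sq_sqrt (by positivity), inv_pow]
      field_simp
      norm_num
    have hm : 1 < ((⌊1 / δ ^ 2⌋₊ : ℝ) + 1) * δ ^ 2 := by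
      have := Nat.lt_floor_add_one (1 / δ ^ 2)
      rwa [div_lt_iff₀ (by positivity)] at this
    obtain ⟨y, hy⟩ := hG.exists_approximation hδ hm
    choose w hw using hy
    have hsub : Set.range (fun x : G.unitEnergySet => y (w x.1 x.2)) ⊆ Set.range y := by
      rintro _ ⟨x, rfl⟩
      exact ⟨_, rfl⟩
    refine ⟨fun x => y (w x.1 x.2), (Set.finite_range y).subset hsub, ?_, ?_⟩
    · have hcard : (Set.range (fun x : G.unitEnergySet => y (w x.1 x.2))).ncard ≤
          (Fintype.card V * Fintype.card V) ^ ⌊1 / δ ^ 2⌋₊ := by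
        refine (Set.ncard_le_ncard hsub (Set.finite_range y)).trans ?_
        rw [← Set.image_univ]
        refine (Set.ncard_image_le Set.finite_univ).trans ?_
        simp [Set.ncard_univ, Nat.card_eq_fintype_card]
      calc _ ≤ (((Fintype.card V * Fintype.card V) ^ ⌊1 / δ ^ 2⌋₊ : ℕ) : ℝ) := by
            exact_mod_cast hcard
        _ = Real.exp (⌊1 / δ ^ 2⌋₊ * (2 * Real.log (Fintype.card V))) := by
            rw [Real.exp_nat_mul, two_mul, Real.exp_add, Real.exp_log (by linarith)]
            push_cast
            rfl
        _ ≤ _ := by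
            refine Real.exp_le_exp.2 ?_
            calc _ ≤ 1 / δ ^ 2 * (2 * Real.log (Fintype.card V)) := by
                  gcongr
                  exact Nat.floor_le (by positivity)
              _ = 6272 * (Real.log (Fintype.card V) * 2 ^ i / ε ^ 2) := by
                  rw [hδsq]
                  field_simp
                  ring
              _ ≤ 6400 * (Real.log (Fintype.card V) * 2 ^ i / ε ^ 2) := by
                  gcongr
                  norm_num
              _ = _ := by ring
    · intro x f u v hf hmax
      refine sq_le_and_le_sq_of_sub_le (c := √((2 : ℝ)⁻¹ ^ i * G.effectiveResistance u v))
        (by positivity) (by linarith) (Real.sqrt_nonneg _) ?_ ?_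
      · rw [Real.sqrt_mul (by positivity), ← mul_assoc]
        exact hw x.1 x.2 u v (hne f u v hf)
      · rwa [Real.sq_sqrt (mul_nonneg (by positivity) (hG.effectiveResistance_nonneg u v))]
  · set K : ℝ := 1 + ∑ e : V × V, G.effectiveResistance e.1 e.2 with hK
    have hRK : ∀ u v, G.effectiveResistance u v + 1 ≤ K := fun u v => by
      have := Finset.single_le_sum (f := fun e : V × V => G.effectiveResistance e.1 e.2)
        (fun e _ => hG.effectiveResistance_nonneg e.1 e.2) (Finset.mem_univ (u, v))
      linarith
    -- Distinct vertices get values at least `K` apart, and `K² ≥ K` exceeds every resistance, hence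
    -- every `(x u - x v)²`.
    let y : V → ℝ := fun v => K * (Fintype.equivFin V v : ℕ)
    have hrange : Set.range (fun _ : G.unitEnergySet => y) ⊆ {y} := by
      rintro _ ⟨-, rfl⟩
      rfl
    refine ⟨fun _ => y, (Set.finite_singleton y).subset hrange, ?_, ?_⟩
    · have hcard := Set.ncard_le_ncard hrange (Set.finite_singleton y)
      rw [Set.ncard_singleton] at hcard
      calc _ ≤ (1 : ℝ) := by exact_mod_cast hcard
        _ ≤ _ := Real.one_le_exp (by positivity)
    · intro x f u v hf _
      have huv := hne f u v hf
      have hx := hG.sq_sub_le_effectiveResistance x.2 huv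
      have hR := hRK u v
      have hR0 := hG.effectiveResistance_nonneg u v
      have hy : G.effectiveResistance u v ≤ (y u - y v) ^ 2 := by
        have hint : (1 : ℝ) ≤
            (((Fintype.equivFin V u : ℕ) : ℝ) - ((Fintype.equivFin V v : ℕ) : ℝ)) ^ 2 := by
          have hne' : (((Fintype.equivFin V u : ℕ) : ℤ) - ((Fintype.equivFin V v : ℕ) : ℤ)) ≠ 0 := by
            intro h
            exact huv ((Fintype.equivFin V).injective (Fin.ext (by omega)))
          have := (one_le_sq_iff_one_le_abs _).2 (Int.one_le_abs hne')
          exact_mod_cast this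
        have : (y u - y v) ^ 2 = K ^ 2 *
            (((Fintype.equivFin V u : ℕ) : ℝ) - ((Fintype.equivFin V v : ℕ) : ℝ)) ^ 2 := by
          simp only [y]
          ring
        rw [this]
        nlinarith [mul_le_mul_of_nonneg_left hint (sq_nonneg K)]
      constructor
      · exact (mul_nonpos_of_nonpos_of_nonneg (by linarith) (sq_nonneg _)).trans (sq_nonneg _)
      · nlinarith [sq_nonneg (y u - y v), mul_nonneg hε.le (sq_nonneg (y u - y v))]
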